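/- **Setting.** Let $\mathcal V$ be a finite set of time series; the series $Z\in\mathcal V$ takes values in a standard Borel space $E_Z$ with a $\sigma$-finite reference measure $\lambda_Z$ (e.g. counting measure for discrete, Lebesgue measure for real variables). Fix a maximal lag $\gamma_{\max}\ge 0$. A *full-time causal graph* (FTCG) is an acyclic directed graph on the variables $Z_s$ ($Z\in\mathcal V$, $s\in\mathbb Z$), invariant under time shifts (consistency throughout time), in which every edge $Z_r\to W_s$ satisfies $0\le s-r\le\gamma_{\max}$. A directed graph $\mathcal G^s$ on $\mathcal V$ (cycles and self-loops allowed) is the *summary causal graph* (SCG) of an FTCG if $Z\to W$ in $\mathcal G^s$ iff $Z_{t-\ell}\to W_t$ in the FTCG for some $0\le\ell\le\gamma_{\max}$; the FTCG is then a *candidate* for $\mathcal G^s$. A *dynamic structural causal model* (DSCM) on an FTCG generates the variables by time-invariant structural equations $Z_s=f_Z(\text{parents of }Z_s,\,U_{Z,s})$ (almost surely), where the noises $U_{Z,s}$ are mutually independent (causal sufficiency), have laws not depending on $s$, and where for each $s$ the noises at times $\ge s$ are jointly independent of all variables before time $s$. It is *positive* if any finitely many variables have a joint law equivalent to (having the same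 null sets as) the product of their reference measures. The intervention $do(X_{t-\gamma}=x_{t-\gamma})$ leaves all variables before time $t-\gamma$ unchanged, replaces the equation of $X_{t-\gamma}$ by the constant $x_{t-\gamma}$, and keeps all other equations and noises; $P(y_t\mid do(x_{t-\gamma}))$ denotes the resulting law of $Y_t$. The total effect $P(y_t\mid do(x_{t-\gamma}))$ is *identifiable* from $\mathcal G^s$ if there is one functional of the observational distribution that equals it, for almost every value $x_{t-\gamma}$, for every positive DSCM on every candidate FTCG of $\mathcal G^s$. A set $\mathcal Z$ of variables is a *valid adjustment set* if for every positive DSCM on every candidate FTCG, for almost every $x_{t-\gamma}$, $$P(y_t\mid do(x_{t-\gamma}))=\int P(y_t\mid x_{t-\gamma},\mathbf z)\,P(d\mathbf z),$$ that is, $\sum_{\mathbf z}P(y_t\mid x_{t-\gamma},\mathbf z)P(\mathbf z)$ for discrete variables. ("Almost every" refers to the law of $X_{t-\gamma}$; for discrete variables with counting reference measure it means every value.) **Graph notions in $\mathcal G^s$.** Every vertex is its own ancestor and descendant. A directed cycle is a sequence of distinct vertices $C^1\to\cdots\to C^k\to C^1$, $k\ge1$ (a self-loop if $k=1$). A path is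 a sequence of distinct vertices in which successive ones are joined by an edge in at least one direction. A path from $X$ to $Y$ is a backdoor path if its first edge is $X\leftarrow$ or $X\leftrightarrows$. It is $\sigma$-active if it contains no $\to Z\leftarrow$ in which neither edge is a double edge $\leftrightarrows$. **Theorem (Identifiability in SCG).** Let $\mathcal G^s$ be a directed graph on $\mathcal V$, $X\neq Y$ two vertices, $\gamma\ge 0$ an integer and $t\in\mathbb Z$. Suppose that $X\notin Anc(Y,\mathcal G^s)$, or that $X\in Anc(Y,\mathcal G^s)$ and none of the following holds: 1. $\gamma\neq 0$ and $\mathcal G^s\setminus\{Y\}$ (the graph with $Y$ and its edges removed) has a directed cycle through $X$ with at least two vertices; 2. there is a $\sigma$-active backdoor path $\langle V^1=X,\dots,V^n=Y\rangle$ from $X$ to $Y$ in $\mathcal G^s$ with $V^2,\dots,V^{n-1}\in Desc(X,\mathcal G^s)$ such that (a) $n>2$, or (b) $n=2$ and $\gamma\neq1$, or (c) $n=2$, $\gamma=1$ and $Y$ lies on a directed cycle of $\mathcal G^s$ (possibly a self-loop) other than $X\leftrightarrows Y$. Then the total effect $P(y_t\mid do(x_{t-\gamma}))$ is identifiable from $\mathcal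 G^s$, and $$\mathcal A_\gamma=\{Z_{t-\gamma-\ell}: 1\le\ell\le\gamma_{\max},\ Z\in Desc(X,\mathcal G^s)\}\cup\{Z_{t-\gamma-\ell}:0\le\ell\le\gamma_{\max},\ Z\in\mathcal V\setminus Desc(X,\mathcal G^s)\}$$ is a valid adjustment set for it. -/

import Mathlib

open MeasureTheory ProbabilityTheory

universe u v w w'

/-! ### Directed graphs (self-loops and cycles allowed) -/

namespace SCG

variable {V : Type u}

/-- `IsAnc G x y`: `x` is an ancestor of `y`, equivalently `y` is a descendant of `x`
(every vertex is its own ancestor and its own descendant). -/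
def IsAnc (G : Digraph V) (x y : V) : Prop := Relation.ReflTransGen G.Adj x y

/-- The set of descendants of `x`. -/
def Desc (G : Digraph V) (x : V) : Set V := {z | IsAnc G x z}

/-- The graph with the vertex `y` and all its edges removed. -/
def removeVertex (G : Digraph V) (y : V) : Digraph V where
  Adj a b := G.Adj a b ∧ a ≠ y ∧ b ≠ y

/-- `c = [x, c₂, …, c_k]` lists the vertices of a directed cycle `x → c₂ → ⋯ → c_k → x`;
`[x]` stands for a self-loop on `x`. -/
def IsCycleThrough (G : Digraph V) (x : V) (c : List V) : Prop :=
  c.Nodup ∧ c.head? = some x ∧ c.IsChain G.Adj ∧ ∃ z, c.getLast? = some z ∧ G.Adj z x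

/-- A path from `x` to `y`: distinct vertices, successive ones being adjacent in some direction. -/
def IsPath (G : Digraph V) (x y : V) (π : List V) : Prop :=
  π.Nodup ∧ π.head? = some x ∧ π.getLast? = some y ∧
    π.IsChain (fun a b => G.Adj a b ∨ G.Adj b a)

/-- A path from `x` to `y` that starts with `x ←` or `x ⇄`. -/
def IsBackdoorPath (G : Digraph V) (x y : V) (π : List V) : Prop :=
  IsPath G x y π ∧ ∃ (a : V) (l : List V), π = x :: a :: l ∧ G.Adj a x

/-- The path contains `→ b ←` where neither of the two edges is bidirected (`⇄`). -/
def SigmaBlocked (G : Digraph V) (π : List V) : Prop :=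
  ∃ a b c : V, [a, b, c] <:+: π ∧
    (G.Adj a b ∧ ¬ G.Adj b a) ∧ (G.Adj c b ∧ ¬ G.Adj b c)

/-- `γ ≠ 0` and some directed cycle through `x` in `G ∖ {y}` has at least two vertices. -/
def CycleCondition (G : Digraph V) (x y : V) (γ : ℕ) : Prop :=
  γ ≠ 0 ∧ ∃ c : List V, IsCycleThrough (removeVertex G y) x c ∧ 2 ≤ c.length

/-- There is a `σ`-active backdoor path from `x` to `y`, with `n` vertices and with interior in
the descendants of `x`, such that `n > 2`, or `n = 2` and `γ ≠ 1`, or `n = 2`, `γ = 1` and `y`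
lies on a directed cycle other than `x ⇄ y`. -/
def BackdoorCondition (G : Digraph V) (x y : V) (γ : ℕ) : Prop :=
  ∃ π : List V, IsBackdoorPath G x y π ∧ ¬ SigmaBlocked G π ∧
    (∀ z ∈ π.tail.dropLast, z ∈ Desc G x) ∧
    (2 < π.length ∨
      (π.length = 2 ∧ γ ≠ 1) ∨
      (π.length = 2 ∧ γ = 1 ∧ ∃ c : List V, IsCycleThrough G y c ∧ c ≠ [y, x]))

/-- The set `A_γ` of the variables `Z_{t-γ-ℓ}` with `1 ≤ ℓ ≤ γmax` for `Z` a descendant of `x`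
and with `0 ≤ ℓ ≤ γmax` for the other `Z`. -/
def adjustmentSet (G : Digraph V) (γmax : ℕ) (x : V) (γ : ℕ) (t : ℤ) : Set (V × ℤ) :=
  {p | ∃ ℓ : ℕ, p.2 = t - γ - ℓ ∧ 1 ≤ ℓ ∧ ℓ ≤ γmax ∧ p.1 ∈ Desc G x} ∪
    {p | ∃ ℓ : ℕ, p.2 = t - γ - ℓ ∧ ℓ ≤ γmax ∧ p.1 ∉ Desc G x}

end SCG

/-! ### Full-time causal graphs -/

/-- A full-time causal graph on the variables `(Z, s)` (the series `Z` at time `s`), with maximal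
lag at most `γmax`, acyclic, and invariant under time shifts (consistency throughout time). -/
structure FTCG (V : Type u) (γmax : ℕ) where
  Edge : V × ℤ → V × ℤ → Prop
  time_le : ∀ p q, Edge p q → p.2 ≤ q.2
  lag_le : ∀ p q, Edge p q → q.2 - p.2 ≤ γmax
  acyclic : ∀ p, ¬ Relation.TransGen Edge p p
  shift : ∀ (a b : V) (r s k : ℤ), Edge (a, r) (b, s) ↔ Edge (a, r + k) (b, s + k)

namespace FTCG

variable {V : Type u} {γmax : ℕ}

/-- The full-time causal graph `G` is a candidate for the summary causal graph `Gs`, that is,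
`Gs` is derived from `G`. -/
def IsCandidate (G : FTCG V γmax) (Gs : Digraph V) : Prop :=
  ∀ (a b : V) (t : ℤ), Gs.Adj a b ↔ ∃ ℓ : ℕ, ℓ ≤ γmax ∧ G.Edge (a, t - ℓ) (b, t)

/-- Parents of the variables of the series `b`, as (series, relative time ≤ 0). -/
abbrev Par (G : FTCG V γmax) (b : V) : Type u := {q : V × ℤ // G.Edge q (b, 0)}

theorem Par.edge {G : FTCG V γmax} {b : V} (q : G.Par b) (s : ℤ) :
    G.Edge (q.1.1, q.1.2 + s) (b, s) := by
  have h := (G.shift q.1.1 b q.1.2 0 s).1 q.2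
  rwa [zero_add] at h

/-- From time `t₀` on, the graph can be computed recursively. -/
theorem wellFounded_from [Finite V] (G : FTCG V γmax) (t₀ : ℤ) :
    WellFounded (fun p q : V × ℤ => G.Edge p q ∧ t₀ ≤ q.2) := by
  have key : ∀ n : ℕ, ∀ p : V × ℤ, p.2 < t₀ + n →
      Acc (fun p q : V × ℤ => G.Edge p q ∧ t₀ ≤ q.2) p := by
    intro n
    induction n with
    | zero =>
      intro p hp
      refine Acc.intro _ fun q hq => ?_
      have := hq.2
      push_cast at hp
      omega
    | succ n ih =>
      rintro ⟨b, s⟩ hp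
      by_cases hs : s < t₀ + n
      · exact ih (b, s) hs
      let r : V → V → Prop := fun a b => Relation.TransGen G.Edge (a, s) (b, s)
      have : IsTrans V r := ⟨fun _ _ _ h₁ h₂ => Relation.TransGen.trans h₁ h₂⟩
      have : Std.Irrefl r := ⟨fun a => G.acyclic (a, s)⟩
      induction b using (Finite.wellFounded_of_trans_of_irrefl r).induction with
      | _ b ihb =>
        refine Acc.intro _ ?_
        rintro ⟨a, s'⟩ hq
        have hle : s' ≤ s := G.time_le _ _ hq.1
        by_cases h : s' < t₀ + n
        · exact ih (a, s') h
        have hss : s' = s := by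
          simp only at hp
          push_cast at hp
          omega
        subst hss
        exact ihb a (Relation.TransGen.single hq.1) hp
  refine ⟨fun p => key (p.2 - t₀ + 1).toNat p ?_⟩
  have := Int.self_le_toNat (p.2 - t₀ + 1)
  omega

end FTCG

/-! ### Dynamic structural causal models -/

/-- A dynamic structural causal model whose full-time causal graph is `G`, together with the
process that it generates. The variable `b` at time `s` is
`X (b, s) = f b (values of the parents of (b, s)) (U (b, s))`.
The mechanisms `f` and the laws of the noises do not depend on time, and the noises are mutually
independent (no hidden common cause). As time has no origin, the structural equations alone do not
say that the process runs forward in time: `noise_indep_past` does. -/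
structure DSCM {V : Type u} {γmax : ℕ} (G : FTCG V γmax) (E : V → Type v)
    [∀ b, MeasurableSpace (E b)] where
  Noise : V → Type w
  [measurableSpaceNoise : ∀ b, MeasurableSpace (Noise b)]
  Ω : Type w'
  [measurableSpaceΩ : MeasurableSpace Ω]
  P : Measure Ω
  [isProbabilityMeasure : IsProbabilityMeasure P]
  f : ∀ b : V, (∀ q : G.Par b, E q.1.1) → Noise b → E b
  measurable_f : ∀ b : V,
    Measurable (fun z : (∀ q : G.Par b, E q.1.1) × Noise b => f b z.1 z.2)
  U : ∀ p : V × ℤ, Ω → Noise p.1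
  measurable_U : ∀ p, Measurable (U p)
  noise_law : ∀ (b : V) (s s' : ℤ), P.map (U (b, s)) = P.map (U (b, s'))
  noise_indep : iIndepFun U P
  X : ∀ p : V × ℤ, Ω → E p.1
  measurable_X : ∀ p, Measurable (X p)
  structural : ∀ (b : V) (s : ℤ), ∀ᵐ ω ∂P,
    X (b, s) ω = f b (fun q => X (q.1.1, q.1.2 + s) ω) (U (b, s) ω)
  noise_indep_past : ∀ s : ℤ, IndepFun
    (fun ω (p : {p : V × ℤ // s ≤ p.2}) => U p.1 ω)
    (fun ω (p : {p : V × ℤ // p.2 < s}) => X p.1 ω) P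

attribute [instance] DSCM.measurableSpaceNoise DSCM.measurableSpaceΩ DSCM.isProbabilityMeasure

namespace DSCM

variable {V : Type u} {γmax : ℕ} {G : FTCG V γmax} {E : V → Type v} [∀ b, MeasurableSpace (E b)]

/-- The observational distribution, a law on trajectories. -/
noncomputable def obsLaw (M : DSCM.{u, v, w, w'} G E) : Measure (∀ p : V × ℤ, E p.1) :=
  M.P.map (fun ω p => M.X p ω)

/-- Positivity: with respect to the reference measures `lam` (counting measure for discrete
variables, Lebesgue measure for real ones), finitely many variables have a joint density that is
positive almost everywhere. -/
def IsPositive (M : DSCM.{u, v, w, w'} G E) (lam : ∀ b, Measure (E b)) : Prop :=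
  ∀ S : Finset (V × ℤ),
    (M.P.map (fun ω (p : S) => M.X p.1 ω)) ≪ Measure.pi (fun p : S => lam p.1.1) ∧
    Measure.pi (fun p : S => lam p.1.1) ≪ (M.P.map (fun ω (p : S) => M.X p.1 ω))

open Classical in
/-- The process under the intervention `do(X i = a)`: nothing changes before the time of `i`, the
variable `i` is set to `a`, and every other variable from then on is computed by its own mechanism
with its own noise. -/
noncomputable def doX [Finite V] (M : DSCM.{u, v, w, w'} G E) (i : V × ℤ) (a : E i.1) (ω : M.Ω) :
    ∀ p : V × ℤ, E p.1 :=
  (G.wellFounded_from i.2).fix (C := fun p => E p.1) fun p rec =>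
    if hp : p.2 < i.2 then M.X p ω
    else if h : p = i then h ▸ a
    else M.f p.1 (fun q => rec (q.1.1, q.1.2 + p.2) ⟨q.edge p.2, not_lt.1 hp⟩) (M.U p ω)

section Unfold

variable [Finite V] (M : DSCM.{u, v, w, w'} G E) (i : V × ℤ) (a : E i.1) (ω : M.Ω)

theorem doX_of_lt (p : V × ℤ) (hp : p.2 < i.2) : M.doX i a ω p = M.X p ω := by
  rw [doX, WellFounded.fix_eq, dif_pos hp]

theorem doX_self : M.doX i a ω i = a := by
  rw [doX, WellFounded.fix_eq, dif_neg (lt_irrefl _), dif_pos rfl]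

theorem doX_of_ne (p : V × ℤ) (hp : i.2 ≤ p.2) (h : p ≠ i) :
    M.doX i a ω p = M.f p.1 (fun q => M.doX i a ω (q.1.1, q.1.2 + p.2)) (M.U p ω) := by
  rw [doX, WellFounded.fix_eq, dif_neg (not_lt.2 hp), dif_neg h]

end Unfold

/-- The total effect `P(X j ∈ · | do(X i = a))`. -/
noncomputable def effect [Finite V] (M : DSCM.{u, v, w, w'} G E) (i j : V × ℤ) (a : E i.1) :
    Measure (E j.1) :=
  M.P.map (fun ω => M.doX i a ω j)

/-- The adjustment formula
`P(X j ∈ · | do(X i = a)) = ∫ P(X j ∈ · | X i = a, X Z = z) P(X Z ∈ dz)`, for almost every `a`. -/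
def AdjustmentFormula [Finite V] [∀ b, StandardBorelSpace (E b)] [∀ b, Nonempty (E b)]
    (M : DSCM.{u, v, w, w'} G E) (i j : V × ℤ) (Z : Set (V × ℤ)) : Prop :=
  ∀ᵐ a ∂(M.P.map (M.X i)), ∀ B : Set (E j.1), MeasurableSet B →
    M.effect i j a B =
      ∫⁻ z, condDistrib (M.X j) (fun ω => (M.X i ω, fun p : Z => M.X p.1 ω)) M.P (a, z) B
        ∂(M.P.map (fun ω (p : Z) => M.X p.1 ω))

end DSCM

/-! ### Identification from a summary causal graph -/

namespace SCG

variable {V : Type u} [Finite V] (E : V → Type v) [∀ b, MeasurableSpace (E b)]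

/-- The effect of `i` on `j` is one and the same functional `Φ` of the observational distribution
for all positive models on all candidate full-time causal graphs of `Gs`. -/
def IsIdentifiable (lam : ∀ b, Measure (E b)) (Gs : Digraph V) (γmax : ℕ) (i j : V × ℤ) : Prop :=
  ∃ Φ : Measure (∀ p : V × ℤ, E p.1) → E i.1 → Measure (E j.1),
    ∀ G : FTCG V γmax, G.IsCandidate Gs → ∀ M : DSCM.{u, v, w, w'} G E, M.IsPositive lam →
      ∀ᵐ a ∂(M.P.map (M.X i)), M.effect i j a = Φ M.obsLaw a

/-- The adjustment formula with the set `Z` holds for all positive models on all candidate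
full-time causal graphs of `Gs`. -/
def IsValidAdjustmentSet [∀ b, StandardBorelSpace (E b)] [∀ b, Nonempty (E b)]
    (lam : ∀ b, Measure (E b)) (Gs : Digraph V) (γmax : ℕ) (i j : V × ℤ) (Z : Set (V × ℤ)) : Prop :=
  ∀ G : FTCG V γmax, G.IsCandidate Gs → ∀ M : DSCM.{u, v, w, w'} G E, M.IsPositive lam →
    M.AdjustmentFormula i j Z

end SCG

/-!
Let `S` be the set of variables, from the time of the treatment on and outside the treatment and
the adjustment set, with a directed path to the outcome avoiding the treatment. Both under
observation and under intervention, the outcome is the same function of the treatment, the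
adjustment set and the noises of `S`, and the adjustment set is not affected by the intervention.

No variable of `S` is an ancestor of the treatment or of the adjustment set. The delicate case is an
ancestor `(w, t - γ)` of the treatment: then `w ≠ x` lies in the strongly connected component of `x`
and on a path to `y`, and branching such a path off a path from `w` to `x` produces a cycle or a
`σ`-active backdoor path of the excluded kind, unless `w = y`, `γ = 1` and every cycle through `y`
is `y ⇄ x`; in that case acyclicity in time rules out a path from `(y, t - 1)` to `(y, t)` that
avoids the treatment.

Hence the noises of `S` are independent of the treatment and the adjustment set jointly, so that the
observational and interventional outcomes have the same conditional laws given these variables.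
Positivity carries this from the joint law of the treatment and the adjustment set to the product of
their laws, which is the adjustment formula for almost every value of the treatment.
-/

section Reachability

variable {α : Type*} {r : α → α → Prop} {p : α → Prop} {a b : α}

theorem exists_nodup_isChain_of_reflTransGen (h : Relation.ReflTransGen r a b) :
    ∃ l : List α, (a :: l).Nodup ∧ (a :: l).IsChain r ∧ (a :: l).getLast? = some b := by
  induction h using Relation.ReflTransGen.head_induction_on with
  | refl => exact ⟨[], List.nodup_singleton b, .singleton b, rfl⟩
  | @head a c hac _ ih =>
    obtain ⟨l, nodup, chain, last⟩ := ih
    by_cases ha : a ∈ c :: l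
    · obtain ⟨s, l', hl'⟩ := List.append_of_mem ha
      rw [hl'] at nodup chain last
      exact ⟨l', nodup.of_append_right, chain.right_of_append, by simpa using last⟩
    · exact ⟨c :: l, List.nodup_cons.2 ⟨ha, nodup⟩, chain.cons_cons hac,
        List.getLast?_cons_cons.trans last⟩

theorem reflTransGen_of_mem_isChain_cons {l : List α} (h : (a :: l).IsChain r) {c : α}
    (hc : c ∈ a :: l) : Relation.ReflTransGen r a c :=
  h.induction _ _ (fun _ _ huv hu => hu.tail huv) (fun _ => .refl) c hc

theorem reflTransGen_of_mem_isChain_of_getLast? {l : List α} (h : l.IsChain r)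
    (hb : l.getLast? = some b) {c : α} (hc : c ∈ l) : Relation.ReflTransGen r c b := by
  obtain ⟨l, rfl⟩ := List.getLast?_eq_some_iff.1 hb
  refine h.backwards_induction (Relation.ReflTransGen r · b) _ (fun _ _ huv hv => .head huv hv)
    (fun _ => ?_) c hc
  rw [List.getLast_concat]

theorem exists_last_exit_of_reflTransGen (h : Relation.ReflTransGen r a b) (ha : p a)
    (hb : ¬ p b) : ∃ c d, Relation.ReflTransGen r a c ∧ p c ∧ r c d ∧ ¬ p d ∧
      Relation.ReflTransGen (fun u v => r u v ∧ ¬ p u ∧ ¬ p v) d b := by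
  induction h with
  | refl => exact absurd ha hb
  | @tail b' b hab' hb'b ih =>
    by_cases hb' : p b'
    · exact ⟨b', b, hab', hb', hb'b, hb, .refl⟩
    · obtain ⟨c, d, hac, hc, hcd, hd, hdb'⟩ := ih hb'
      exact ⟨c, d, hac, hc, hcd, hd, hdb'.tail ⟨hb'b, hb', hb⟩⟩

theorem exists_first_entrance_of_reflTransGen (h : Relation.ReflTransGen r a b) (ha : ¬ p a)
    (hb : p b) : ∃ c d, Relation.ReflTransGen (fun u v => r u v ∧ ¬ p u ∧ ¬ p v) a c ∧ ¬ p c ∧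
      r c d ∧ p d ∧ Relation.ReflTransGen r d b := by
  induction h using Relation.ReflTransGen.head_induction_on with
  | refl => exact absurd hb ha
  | @head a a' haa' ha'b ih =>
    by_cases ha' : p a'
    · exact ⟨a, a', .refl, ha, haa', ha', ha'b⟩
    · obtain ⟨c, d, ha'c, hc, hcd, hd, hdb⟩ := ih ha'
      exact ⟨c, d, ha'c.head ⟨haa', ha, ha'⟩, hc, hcd, hd, hdb⟩

theorem rel_or_rel_of_infix_fork {k m : List α} {u v w : α}
    (hk : (a :: k).IsChain r) (hm : (a :: m).IsChain r)
    (h : [u, v, w] <:+: k.reverse ++ a :: m) : r v u ∨ r v w := by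
  obtain ⟨s, t, hst⟩ := h
  have hsplit : (s ++ [u]) ++ (v :: w :: t) = k.reverse ++ a :: m := by simpa using hst
  obtain ⟨e, hl, hr⟩ | ⟨e, -, hr⟩ := List.append_eq_append_iff.1 hsplit
  · left
    have hchain : (k.reverse ++ [a]).IsChain (flip r) := by
      rw [← List.reverse_cons]
      exact List.isChain_reverse.2 hk
    cases e with
    | nil =>
      obtain ⟨rfl, -⟩ : v = a ∧ w :: t = m := by simpa using hr
      rw [hl, List.append_nil, List.append_assoc] at hchain
      exact (List.isChain_cons_cons.1 hchain.right_of_append).1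
    | cons v' e =>
      obtain ⟨rfl, -⟩ : v = v' ∧ w :: t = e ++ a :: m := by simpa using hr
      rw [hl, List.append_assoc, List.append_assoc] at hchain
      exact (List.isChain_cons_cons.1 hchain.right_of_append).1
  · right
    rw [hr] at hm
    exact (List.isChain_cons_cons.1 hm.right_of_append).1

end Reachability

namespace SCG

section Digraph

variable {V : Type*} {G : Digraph V} {a b v w x y : V} {γ : ℕ}

theorem IsAnc.of_removeVertex (h : IsAnc (removeVertex G y) a b) : IsAnc G a b :=
  Relation.ReflTransGen.mono (fun _ _ hadj => hadj.1) _ _ h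

theorem IsAnc.removeVertex (h : IsAnc G a b) (hy : ¬ IsAnc G y b) :
    IsAnc (removeVertex G y) a b := by
  induction h using Relation.ReflTransGen.head_induction_on with
  | refl => exact .refl
  | @head a c hac hcb ih =>
    refine .head ⟨hac, ?_, ?_⟩ ih
    · rintro rfl
      exact hy (.head hac hcb)
    · rintro rfl
      exact hy hcb

theorem exists_isCycleThrough_of_adj (hvx : v ≠ x) (hadj : G.Adj x v) (h : IsAnc G v x) :
    ∃ l : List V, IsCycleThrough G x (x :: v :: l) := by
  obtain ⟨l, nodup, chain, last⟩ := exists_nodup_isChain_of_reflTransGen h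
  obtain ⟨m, hm⟩ := List.getLast?_eq_some_iff.1 last
  obtain _ | ⟨v', m⟩ := m
  · exact absurd (List.cons.inj hm).1 hvx
  obtain rfl : v = v' := (List.cons.inj hm).1
  rw [hm] at nodup chain
  obtain ⟨chain', -, hlast⟩ := List.isChain_append.1 chain
  have hz := List.getLast?_eq_some_getLast (List.cons_ne_nil v m)
  exact ⟨m, List.nodup_append_comm.1 nodup, rfl, chain'.cons_cons hadj, _,
    List.getLast?_cons_cons.trans hz, hlast _ hz x rfl⟩

theorem exists_isCycleThrough_getLast?_of_adj (hadj : G.Adj v x) (h : IsAnc G x v) :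
    ∃ c : List V, IsCycleThrough G x c ∧ c.getLast? = some v := by
  obtain ⟨l, nodup, chain, last⟩ := exists_nodup_isChain_of_reflTransGen h
  exact ⟨x :: l, ⟨nodup, rfl, chain, v, last, hadj⟩, last⟩

theorem cycleCondition_of_isAnc (hγ : γ ≠ 0) (hwx : w ≠ x)
    (hxw : IsAnc (removeVertex G y) x w) (hwx' : IsAnc (removeVertex G y) w x) :
    CycleCondition G x y γ := by
  obtain ⟨u, v, -, hu, hadj, hv, hvw⟩ :=
    exists_last_exit_of_reflTransGen (p := (· = x)) hxw rfl hwx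
  rw [hu] at hadj
  have hvw' : IsAnc (removeVertex G y) v w :=
    Relation.ReflTransGen.mono (fun _ _ h => h.1) _ _ hvw
  obtain ⟨l, hl⟩ := exists_isCycleThrough_of_adj hv hadj (hvw'.trans hwx')
  exact ⟨hγ, _, hl, by simp⟩

section Fork

variable {k m : List V}

theorem isBackdoorPath_fork (hab : G.Adj a b) (hk : (b :: k).IsChain G.Adj)
    (hx : (b :: k).getLast? = some x) (hm : (a :: m).IsChain G.Adj)
    (hy : (a :: m).getLast? = some y) (hn : ((b :: k).reverse ++ a :: m).Nodup) :
    IsBackdoorPath G x y ((b :: k).reverse ++ a :: m) := by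
  have hchain : ((b :: k).reverse ++ [a]).IsChain (flip G.Adj) := by
    rw [← List.reverse_cons]
    exact List.isChain_reverse.2 (hk.cons_cons hab)
  obtain ⟨l, hl⟩ := List.getLast?_eq_some_iff.1 hx
  have hrev : (b :: k).reverse = x :: l.reverse := by rw [hl, List.reverse_concat]
  rw [hrev] at hn hchain ⊢
  refine ⟨⟨hn, rfl, ?_, ?_⟩, ?_⟩
  · rw [List.getLast?_append_of_ne_nil _ (List.cons_ne_nil a m), hy]
  · exact List.isChain_split.2
      ⟨hchain.imp fun _ _ h => .inr h, hm.imp fun _ _ h => .inl h⟩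
  · cases hr : l.reverse with
    | nil =>
      rw [hr] at hchain
      exact ⟨a, m, rfl, (List.isChain_cons_cons.1 hchain).1⟩
    | cons c r =>
      rw [hr] at hchain
      exact ⟨c, r ++ a :: m, rfl, (List.isChain_cons_cons.1 hchain).1⟩

theorem not_sigmaBlocked_fork (hab : G.Adj a b) (hk : (b :: k).IsChain G.Adj)
    (hm : (a :: m).IsChain G.Adj) : ¬ SigmaBlocked G ((b :: k).reverse ++ a :: m) := by
  rintro ⟨u, v, w, hinfix, ⟨-, hvu⟩, -, hvw⟩
  exact (rel_or_rel_of_infix_fork (hk.cons_cons hab) hm hinfix).elim hvu hvw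

end Fork

theorem exists_isBackdoorPath_not_sigmaBlocked (hxy : x ≠ y) (hxw : IsAnc G x w)
    (hwx : IsAnc G w x) (hwy : IsAnc (removeVertex G x) w y) :
    ∃ π : List V, IsBackdoorPath G x y π ∧ ¬ SigmaBlocked G π ∧ ∀ z ∈ π, z ∈ Desc G x := by
  -- Branch off at the last vertex `a` of the walk `w → ⋯ → x` with a walk to `y` avoiding `x`.
  let p : V → Prop := fun v => IsAnc (removeVertex G x) v y
  have hx : ¬ p x := fun h => by
    obtain h | ⟨_, hadj, -⟩ := Relation.ReflTransGen.cases_head h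
    exacts [hxy h, hadj.2.1 rfl]
  obtain ⟨a, b, hwa, ha, hab, hb, hbx⟩ := exists_last_exit_of_reflTransGen (p := p) hwx hwy hx
  obtain ⟨k, nodup_k, chain_k, last_k⟩ := exists_nodup_isChain_of_reflTransGen hbx
  obtain ⟨m, nodup_m, chain_m, last_m⟩ := exists_nodup_isChain_of_reflTransGen ha
  have hm : ∀ z ∈ a :: m, p z := fun z hz =>
    reflTransGen_of_mem_isChain_of_getLast? chain_m last_m hz
  have hk : ∀ z ∈ b :: k, ¬ p z :=
    chain_k.induction (¬ p ·) _ (fun _ _ h _ => h.2.2) fun _ => hb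
  have chain_k' : (b :: k).IsChain G.Adj := chain_k.imp fun _ _ h => h.1
  have chain_m' : (a :: m).IsChain G.Adj := chain_m.imp fun _ _ h => h.1
  have hxa : IsAnc G x a := hxw.trans hwa
  refine ⟨(b :: k).reverse ++ a :: m,
    isBackdoorPath_fork hab chain_k' last_k chain_m' last_m ?_,
    not_sigmaBlocked_fork hab chain_k' chain_m', fun z hz => ?_⟩
  · refine List.nodup_append.2 ⟨List.nodup_reverse.2 nodup_k, nodup_m, ?_⟩
    rintro z hz _ hz' rfl
    exact hk z (List.mem_reverse.1 hz) (hm z hz')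
  · obtain hz | hz := List.mem_append.1 hz
    · exact (hxa.tail hab).trans
        (reflTransGen_of_mem_isChain_cons chain_k' (List.mem_reverse.1 hz))
    · exact hxa.trans (reflTransGen_of_mem_isChain_cons chain_m' hz)

theorem eq_one_and_forall_isCycleThrough_eq_of_not_backdoorCondition
    (hbackdoor : ¬ BackdoorCondition G x y γ) (hxy : x ≠ y) (hxw : IsAnc G x w)
    (hwx : IsAnc G w x) (hwy : IsAnc (removeVertex G x) w y) :
    γ = 1 ∧ ∀ c, IsCycleThrough G y c → c = [y, x] := by
  obtain ⟨π, hπ, hactive, hdesc⟩ := exists_isBackdoorPath_not_sigmaBlocked hxy hxw hwx hwy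
  have hexcluded := fun h => hbackdoor
    ⟨π, hπ, hactive, fun z hz => hdesc z (List.mem_of_mem_tail (List.mem_of_mem_dropLast hz)), h⟩
  obtain ⟨-, _, l, rfl, -⟩ := hπ
  simp only [List.length_cons] at hexcluded
  obtain rfl : l = [] := by
    by_contra hl
    have := List.length_pos_iff.2 hl
    exact hexcluded (.inl (by omega))
  have hγ : γ = 1 := by
    by_contra hγ
    exact hexcluded (.inr (.inl ⟨rfl, hγ⟩))
  refine ⟨hγ, fun c hc => ?_⟩
  by_contra hne
  exact hexcluded (.inr (.inr ⟨rfl, hγ, c, hc, hne⟩))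

theorem eq_of_adj_of_isAnc_of_forall_isCycleThrough
    (hcycles : ∀ c, IsCycleThrough G y c → c = [y, x]) (hadj : G.Adj v y)
    (h : IsAnc G y v) : v = x := by
  obtain ⟨c, hc, hlast⟩ := exists_isCycleThrough_getLast?_of_adj hadj h
  rw [hcycles c hc] at hlast
  exact (Option.some.inj hlast).symm

theorem eq_of_isAnc_of_adj_of_forall_isCycleThrough
    (hcycles : ∀ c, IsCycleThrough G y c → c = [y, x]) (hxy : x ≠ y) (hadj : G.Adj y v)
    (h : IsAnc G v y) : v = x := by
  have hvy : v ≠ y := by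
    rintro rfl
    exact hxy (eq_of_adj_of_isAnc_of_forall_isCycleThrough hcycles hadj .refl).symm
  obtain ⟨l, hl⟩ := exists_isCycleThrough_of_adj hvy hadj h
  exact (List.cons.inj (List.cons.inj (hcycles _ hl)).2).1

theorem isAnc_removeVertex_of_forall_isCycleThrough
    (hcycles : ∀ c, IsCycleThrough G y c → c = [y, x]) (hxy : x ≠ y) (hw : w ≠ y)
    (hyw : IsAnc G y w) (hwy : IsAnc G w y) :
    IsAnc (removeVertex G y) x w ∧ IsAnc (removeVertex G y) w x := by
  constructor
  · obtain ⟨c, d, -, hc, hadj, -, hdw⟩ :=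
      exists_last_exit_of_reflTransGen (p := (· = y)) hyw rfl hw
    replace hdw : IsAnc (removeVertex G y) d w := hdw
    rw [hc] at hadj
    rwa [← eq_of_isAnc_of_adj_of_forall_isCycleThrough hcycles hxy hadj
      (hdw.of_removeVertex.trans hwy)]
  · obtain ⟨c, d, hwc, -, hadj, hd, -⟩ :=
      exists_first_entrance_of_reflTransGen (p := (· = y)) hwy hw rfl
    replace hwc : IsAnc (removeVertex G y) w c := hwc
    rw [hd] at hadj
    rwa [← eq_of_adj_of_isAnc_of_forall_isCycleThrough hcycles hadj
      (hyw.trans hwc.of_removeVertex)]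

theorem eq_outcome_of_mem_strongComponent (hxy : x ≠ y) (hγ : γ ≠ 0) (hanc : IsAnc G x y)
    (hcycle : ¬ CycleCondition G x y γ) (hbackdoor : ¬ BackdoorCondition G x y γ)
    (hw : w ≠ x) (hxw : IsAnc G x w) (hwx : IsAnc G w x) :
    w = y ∧ γ = 1 ∧ ∀ v, G.Adj y v → IsAnc G v y → v = x := by
  have hyx : IsAnc G y x := by
    by_contra hyx
    exact hcycle (cycleCondition_of_isAnc hγ hw
      (hxw.removeVertex fun h => hyx (h.trans hwx)) (hwx.removeVertex hyx))
  obtain ⟨hγ1, hcycles⟩ := eq_one_and_forall_isCycleThrough_eq_of_not_backdoorCondition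
    hbackdoor hxy hanc hyx .refl
  refine ⟨?_, hγ1, fun _ => eq_of_isAnc_of_adj_of_forall_isCycleThrough hcycles hxy⟩
  by_contra hwy
  obtain ⟨hxw', hwx'⟩ := isAnc_removeVertex_of_forall_isCycleThrough hcycles hxy hwy
    (hyx.trans hxw) (hwx.trans hanc)
  exact hcycle (cycleCondition_of_isAnc hγ hw hxw' hwx')

theorem mem_adjustmentSet_iff {γmax : ℕ} {t : ℤ} {p : V × ℤ} :
    p ∈ adjustmentSet G γmax x γ t ↔
      t - γ - γmax ≤ p.2 ∧ (p.2 < t - γ ∨ p.2 = t - γ ∧ ¬ IsAnc G x p.1) := by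
  constructor
  · rintro (⟨ℓ, hp, hℓ, hℓ', -⟩ | ⟨ℓ, hp, hℓ, hdesc⟩)
    · exact ⟨by omega, .inl (by omega)⟩
    · refine ⟨by omega, ?_⟩
      obtain rfl | hℓ := Nat.eq_zero_or_pos ℓ
      · exact .inr ⟨by omega, hdesc⟩
      · exact .inl (by omega)
  · rintro ⟨hmax, hlt | ⟨heq, hdesc⟩⟩
    · by_cases hp : p.1 ∈ Desc G x
      · exact .inl ⟨(t - γ - p.2).toNat, by omega, by omega, by omega, hp⟩
      · exact .inr ⟨(t - γ - p.2).toNat, by omega, by omega, hp⟩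
    · exact .inr ⟨0, by omega, by omega, hdesc⟩

theorem finite_adjustmentSet [Finite V] (G : Digraph V) (γmax : ℕ) (x : V) (γ : ℕ) (t : ℤ) :
    (adjustmentSet G γmax x γ t).Finite := by
  refine (Set.finite_univ.prod (Set.finite_Icc (t - γ - γmax) (t - γ))).subset fun p hp => ?_
  obtain ⟨hmax, h⟩ := mem_adjustmentSet_iff.1 hp
  exact ⟨trivial, hmax, h.elim le_of_lt fun h => h.1.le⟩

end Digraph

end SCG

namespace FTCG

section Paths

variable {V : Type*} {γmax : ℕ} {G : FTCG V γmax} {Gs : Digraph V} {i p q : V × ℤ}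

/-- The full-time causal graph as a directed graph on the variables `(Z, s)`, so that the notions
defined for summary causal graphs (ancestors, vertex removal) apply to it. -/
def toDigraph (G : FTCG V γmax) : Digraph (V × ℤ) where
  Adj := G.Edge

theorem time_le_of_isAnc (h : SCG.IsAnc G.toDigraph p q) : p.2 ≤ q.2 := by
  induction h with
  | refl => exact le_rfl
  | tail _ hedge ih => exact ih.trans (G.time_le _ _ hedge)

theorem isAnc_add_time (k : ℤ) (h : SCG.IsAnc G.toDigraph p q) :
    SCG.IsAnc G.toDigraph (p.1, p.2 + k) (q.1, q.2 + k) :=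
  Relation.ReflTransGen.lift (fun p : V × ℤ => (p.1, p.2 + k))
    (fun a b hab => (G.shift a.1 b.1 a.2 b.2 k).1 hab) _ _ h

theorem eq_of_isAnc_of_isAnc (h : SCG.IsAnc G.toDigraph p q) (h' : SCG.IsAnc G.toDigraph q p) :
    p = q := by
  obtain h | h := Relation.reflTransGen_iff_eq_or_transGen.1 h
  · exact h.symm
  · exact absurd (h.trans_left h') (G.acyclic p)

theorem IsCandidate.adj (hG : G.IsCandidate Gs) (h : G.Edge p q) : Gs.Adj p.1 q.1 := by
  have hle := G.time_le _ _ h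
  have hlag := G.lag_le _ _ h
  refine (hG p.1 q.1 q.2).2 ⟨(q.2 - p.2).toNat, by omega, ?_⟩
  rwa [Int.toNat_of_nonneg (by omega), sub_sub_cancel]

theorem IsCandidate.isAnc (hG : G.IsCandidate Gs) (h : SCG.IsAnc G.toDigraph p q) :
    SCG.IsAnc Gs p.1 q.1 :=
  Relation.ReflTransGen.lift Prod.fst (fun _ _ hedge => hG.adj hedge) _ _ h

theorem IsCandidate.isAnc_removeVertex (hG : G.IsCandidate Gs)
    (h : SCG.IsAnc (SCG.removeVertex G.toDigraph i) p q) (hp : i.2 ≤ p.2) (hq : q.2 = i.2) :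
    SCG.IsAnc (SCG.removeVertex Gs i.1) p.1 q.1 := by
  induction h using Relation.ReflTransGen.head_induction_on with
  | refl => exact .refl
  | @head p c hpc hcq ih =>
    have hpc_time := G.time_le _ _ hpc.1
    have hcq_time := time_le_of_isAnc (SCG.IsAnc.of_removeVertex hcq)
    exact .head ⟨hG.adj hpc.1, fun h => hpc.2.1 (Prod.ext h (by omega)),
      fun h => hpc.2.2 (Prod.ext h (by omega))⟩ (ih (by omega))

theorem IsCandidate.not_isAnc_removeVertex_add_one {x y : V} {s : ℤ} (hG : G.IsCandidate Gs)
    (hxy : x ≠ y) (hout : ∀ v, Gs.Adj y v → SCG.IsAnc Gs v y → v = x)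
    (hyx : SCG.IsAnc G.toDigraph (y, s) (x, s)) :
    ¬ SCG.IsAnc (SCG.removeVertex G.toDigraph (x, s)) (y, s) (y, s + 1) := by
  intro hyy
  obtain heq | ⟨⟨v, r⟩, hedge, hvy⟩ := Relation.ReflTransGen.cases_head hyy
  · exact absurd (congrArg Prod.snd heq) (by simp)
  replace hvy : SCG.IsAnc G.toDigraph (v, r) (y, s + 1) := SCG.IsAnc.of_removeVertex hvy
  obtain rfl : v = x := hout v (hG.adj hedge.1) (hG.isAnc hvy)
  have hsr : s ≤ r := G.time_le _ _ hedge.1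
  have hrs : r ≤ s + 1 := time_le_of_isAnc hvy
  have hne : r ≠ s := fun h => hedge.2.2 (Prod.ext rfl h)
  obtain rfl : r = s + 1 := by omega
  exact hxy (congrArg Prod.fst (eq_of_isAnc_of_isAnc hvy (isAnc_add_time 1 hyx)))

end Paths

section OutcomeAncestors

variable {V : Type*} {γmax : ℕ}

/-- The variables, from the time of the treatment `i` on and outside `A ∪ {i}`, with a directed
path to the outcome `j` that avoids `i`. These are the variables through which `j` is computed
from `i`, the variables in `A` and the noises. -/
def outcomeAncestors (G : FTCG V γmax) (A : Set (V × ℤ)) (i j : V × ℤ) : Set (V × ℤ) :=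
  {p | i.2 ≤ p.2 ∧ p ∉ A ∧ p ≠ i ∧ SCG.IsAnc (SCG.removeVertex G.toDigraph i) p j}

variable {G : FTCG V γmax} {Gs : Digraph V} {γ : ℕ} {t : ℤ} {x y : V} {j p q : V × ℤ}

theorem mem_outcomeAncestors_or_of_edge
    (hp : p ∈ G.outcomeAncestors (SCG.adjustmentSet Gs γmax x γ t) (x, t - γ) j)
    (h : G.Edge q p) :
    q ∈ G.outcomeAncestors (SCG.adjustmentSet Gs γmax x γ t) (x, t - γ) j ∨
      q ∈ SCG.adjustmentSet Gs γmax x γ t ∨ q = (x, t - γ) := by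
  obtain ⟨hp_time, -, hp_ne, hpj⟩ := hp
  by_contra! ⟨hq, hqA, hq_ne⟩
  refine hq ⟨?_, hqA, hq_ne, .head ⟨h, hq_ne, hp_ne⟩ hpj⟩
  by_contra! hlt
  have hlag := G.lag_le _ _ h
  dsimp only at hp_time hlt
  exact hqA (SCG.mem_adjustmentSet_iff.2 ⟨by omega, .inl hlt⟩)

theorem IsCandidate.not_isAnc_treatment_adjustmentSet (hG : G.IsCandidate Gs)
    (hq : q ∈ SCG.adjustmentSet Gs γmax x γ t) :
    ¬ SCG.IsAnc G.toDigraph (x, t - γ) q := fun h =>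
  (SCG.mem_adjustmentSet_iff.1 hq).2.elim
    (fun hlt => absurd (time_le_of_isAnc h) (not_le.2 hlt)) fun hq => hq.2 (hG.isAnc h)

theorem IsCandidate.not_isAnc_outcomeAncestors_adjustmentSet (hG : G.IsCandidate Gs)
    (hp : p ∈ G.outcomeAncestors (SCG.adjustmentSet Gs γmax x γ t) (x, t - γ) j)
    (hq : q ∈ SCG.adjustmentSet Gs γmax x γ t) : ¬ SCG.IsAnc G.toDigraph p q := by
  intro h
  obtain ⟨hp_time, hpA, -⟩ := hp
  have hle := time_le_of_isAnc h
  dsimp only at hp_time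
  obtain ⟨-, hlt | ⟨hq_time, hdesc⟩⟩ := SCG.mem_adjustmentSet_iff.1 hq
  · omega
  · exact hpA (SCG.mem_adjustmentSet_iff.2 ⟨by omega, .inr ⟨by omega, fun hxp =>
      hdesc (hxp.trans (hG.isAnc h))⟩⟩)

theorem IsCandidate.not_isAnc_outcomeAncestors_treatment (hG : G.IsCandidate Gs) (hxy : x ≠ y)
    (h : ¬ SCG.IsAnc Gs x y ∨ (SCG.IsAnc Gs x y ∧ ¬ SCG.CycleCondition Gs x y γ ∧
      ¬ SCG.BackdoorCondition Gs x y γ))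
    (hp : p ∈ G.outcomeAncestors (SCG.adjustmentSet Gs γmax x γ t) (x, t - γ) (y, t)) :
    ¬ SCG.IsAnc G.toDigraph p (x, t - γ) := by
  intro hpi
  obtain ⟨w, s⟩ := p
  obtain ⟨hp_time, hpA, hp_ne, hpj⟩ := hp
  obtain rfl : s = t - γ := le_antisymm (time_le_of_isAnc hpi) hp_time
  have hwx : w ≠ x := fun h => hp_ne (Prod.ext h rfl)
  have hxw : SCG.IsAnc Gs x w := by
    by_contra hdesc
    exact hpA (SCG.mem_adjustmentSet_iff.2 ⟨by simp, .inr ⟨rfl, hdesc⟩⟩)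
  have hwx_anc : SCG.IsAnc Gs w x := hG.isAnc hpi
  have hwy : SCG.IsAnc Gs w y := hG.isAnc (SCG.IsAnc.of_removeVertex hpj)
  obtain hanc | ⟨hanc, hcycle, hbackdoor⟩ := h
  · exact hanc (hxw.trans hwy)
  obtain rfl | hγ := eq_or_ne γ 0
  · have hwy' := hG.isAnc_removeVertex hpj le_rfl (by simp)
    exact absurd (SCG.eq_one_and_forall_isCycleThrough_eq_of_not_backdoorCondition hbackdoor hxy
      hxw hwx_anc hwy').1 zero_ne_one
  · obtain ⟨rfl, rfl, hout⟩ := SCG.eq_outcome_of_mem_strongComponent hxy hγ hanc hcycle hbackdoor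
      hwx hxw hwx_anc
    exact hG.not_isAnc_removeVertex_add_one hxy hout hpi (by simpa using hpj)

end OutcomeAncestors

end FTCG

section Independence

variable {Ω : Type*} [MeasurableSpace Ω] {μ : Measure Ω}

theorem indepFun_prodMk_of_indepFun_prodMk [IsFiniteMeasure μ] {α β δ : Type*}
    [MeasurableSpace α] [MeasurableSpace β] [MeasurableSpace δ] {f : Ω → α} {g : Ω → β}
    {h : Ω → δ} (hf : Measurable f) (hg : Measurable g) (hh : Measurable h) (hfg : f ⟂ᵢ[μ] g)
    (hfgh : (fun ω => (f ω, g ω)) ⟂ᵢ[μ] h) : f ⟂ᵢ[μ] (fun ω => (g ω, h ω)) := by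
  have hgh : g ⟂ᵢ[μ] h := hfgh.comp (φ := Prod.snd) (ψ := id) measurable_snd measurable_id
  rw [indepFun_iff_map_prod_eq_prod_map_map (by fun_prop) (by fun_prop)] at hfg hfgh hgh ⊢
  calc μ.map (fun ω => (f ω, g ω, h ω))
      = (μ.map fun ω => ((f ω, g ω), h ω)).map MeasurableEquiv.prodAssoc := by
        rw [Measure.map_map (by fun_prop) (by fun_prop)]; rfl
    _ = (((μ.map f).prod (μ.map g)).prod (μ.map h)).map MeasurableEquiv.prodAssoc := by
        rw [hfgh, hfg]
    _ = (μ.map f).prod ((μ.map g).prod (μ.map h)) := Measure.prodAssoc_prod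
    _ = (μ.map f).prod (μ.map fun ω => (g ω, h ω)) := by rw [hgh]

theorem indepFun_restrict_of_disjoint {ι : Type*} {β : ι → Type*} [∀ k, MeasurableSpace (β k)]
    {f : ∀ k, Ω → β k} (hf : iIndepFun f μ) (hmeas : ∀ k, Measurable (f k)) {S T : Set ι}
    (hST : Disjoint S T) : (fun ω (k : S) => f k ω) ⟂ᵢ[μ] (fun ω (k : T) => f k ω) := by
  have h := indep_iSup_of_disjoint (fun k => (hmeas k).comap_le) hf hST
  rw [iSup_subtype', iSup_subtype'] at h
  rwa [IndepFun_iff_Indep, MeasurableSpace.comap_process_pi fun (k : S) ω => f k ω,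
    MeasurableSpace.comap_process_pi fun (k : T) ω => f k ω]

end Independence

section Adjustment

variable {Ω α β υ ψ : Type*} [MeasurableSpace Ω] [MeasurableSpace α] [MeasurableSpace β]
  [MeasurableSpace υ] [MeasurableSpace ψ] {μ : Measure Ω} [IsFiniteMeasure μ]

theorem map_apply_eq_lintegral_of_indepFun {W : Ω → β} {U : Ω → υ} {F : β × υ → ψ}
    (hW : Measurable W) (hU : Measurable U) (hF : Measurable F) (hind : W ⟂ᵢ[μ] U) {B : Set ψ}
    (hB : MeasurableSet B) :
    μ.map (fun ω => F (W ω, U ω)) B = ∫⁻ w, μ.map (fun ω => F (w, U ω)) B ∂μ.map W := by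
  rw [← Function.comp_def F, ← Measure.map_map hF (by fun_prop),
    hind.map_prod_eq_prod_map_map (by fun_prop) (by fun_prop), Measure.map_apply hF hB,
    Measure.prod_apply (hF hB)]
  refine lintegral_congr fun w => ?_
  rw [Measure.map_apply hU (measurable_prodMk_left (hF hB)), Measure.map_apply (by fun_prop) hB]
  rfl

variable [StandardBorelSpace ψ] [Nonempty ψ]

theorem condDistrib_ae_eq_map_of_indepFun {W : Ω → β} {U : Ω → υ} {Y : Ω → ψ} {H : β × υ → ψ}
    (hW : Measurable W) (hU : Measurable U) (hY : Measurable Y) (hH : Measurable H)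
    (hYH : ∀ᵐ ω ∂μ, Y ω = H (W ω, U ω)) (hind : W ⟂ᵢ[μ] U) :
    ∀ᵐ w ∂μ.map W, condDistrib Y W μ w = μ.map fun ω => H (w, U ω) := by
  let κ : Kernel β ψ := (Kernel.id ×ₖ Kernel.const β (μ.map U)).map H
  have hκ (w : β) : κ w = μ.map fun ω => H (w, U ω) := by
    rw [Kernel.map_apply _ hH, Kernel.prod_apply, Kernel.id_apply, Kernel.const_apply,
      Measure.dirac_prod, Measure.map_map hH (by fun_prop), Measure.map_map (by fun_prop) hU]
    rfl
  have hjoint : μ.map (fun ω => (W ω, Y ω)) = μ.map W ⊗ₘ κ := by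
    ext s hs
    rw [Measure.map_congr (hYH.mono fun ω h => congrArg (Prod.mk (W ω)) h),
      map_apply_eq_lintegral_of_indepFun (F := fun p => (p.1, H p)) hW hU (by fun_prop) hind hs,
      Measure.compProd_apply hs]
    refine lintegral_congr fun w => ?_
    rw [hκ, Measure.map_apply (by fun_prop) hs,
      Measure.map_apply (by fun_prop) (measurable_prodMk_left hs)]
    rfl
  filter_upwards [condDistrib_ae_eq_of_measure_eq_compProd W hY.aemeasurable hjoint] with w hw
  rw [hw, hκ]

theorem ae_map_eq_lintegral_condDistrib {A : Ω → α} {Z : Ω → β} {U : Ω → υ} {Y : Ω → ψ}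
    {H : (α × β) × υ → ψ} (hA : Measurable A) (hZ : Measurable Z) (hU : Measurable U)
    (hY : Measurable Y) (hH : Measurable H) (hYH : ∀ᵐ ω ∂μ, Y ω = H ((A ω, Z ω), U ω))
    (hind : (fun ω => (A ω, Z ω)) ⟂ᵢ[μ] U)
    (hac : (μ.map A).prod (μ.map Z) ≪ μ.map fun ω => (A ω, Z ω)) :
    ∀ᵐ a ∂μ.map A, ∀ B : Set ψ, MeasurableSet B →
      μ.map (fun ω => H ((a, Z ω), U ω)) B =
        ∫⁻ z, condDistrib Y (fun ω => (A ω, Z ω)) μ (a, z) B ∂μ.map Z := by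
  have hcond := condDistrib_ae_eq_map_of_indepFun (hA.prodMk hZ) hU hY hH hYH hind
  have hZU : Z ⟂ᵢ[μ] U := hind.comp (φ := Prod.snd) (ψ := id) measurable_snd measurable_id
  filter_upwards [Measure.ae_ae_of_ae_prod (hac.ae_le hcond)] with a ha B hB
  rw [map_apply_eq_lintegral_of_indepFun (F := fun p => H ((a, p.1), p.2)) hZ hU (by fun_prop)
    hZU hB]
  exact lintegral_congr_ae (ha.mono fun z hz => (congrArg (· B) hz).symm)

theorem condDistrib_comp_eq_condDistrib_map {Y : α → ψ} {X : α → β} {f : Ω → α}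
    (hY : Measurable Y) (hX : Measurable X) (hf : Measurable f) :
    condDistrib (Y ∘ f) (X ∘ f) μ = condDistrib Y X (μ.map f) := by
  rw [condDistrib, condDistrib]
  congr 1
  rw [Measure.map_map (by fun_prop) hf]
  rfl

end Adjustment

section UpdateSet

variable {ι : Type*} {π : ι → Type*} {S : Set ι} {i : ι}

open Classical in
/-- The family `d` with its values on the set `S` replaced by `y`; the analogue for arbitrary sets
of `Function.updateFinset`. -/
noncomputable def updateSet (d : ∀ i, π i) (S : Set ι) (y : ∀ i : S, π i) (i : ι) : π i :=
  if hi : i ∈ S then y ⟨i, hi⟩ else d i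

theorem updateSet_of_mem (d : ∀ i, π i) (y : ∀ i : S, π i) (hi : i ∈ S) :
    updateSet d S y i = y ⟨i, hi⟩ :=
  dif_pos hi

@[fun_prop]
theorem measurable_updateSet [∀ i, MeasurableSpace (π i)] (d : ∀ i, π i) :
    Measurable (updateSet d S) := by
  refine measurable_pi_lambda _ fun i => ?_
  unfold updateSet
  split_ifs <;> fun_prop

end UpdateSet

attribute [fun_prop] DSCM.measurable_X DSCM.measurable_U

namespace DSCM

section Positivity

variable {V : Type u} {γmax : ℕ} {G : FTCG V γmax} {E : V → Type v} [∀ b, MeasurableSpace (E b)]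
  {M : DSCM.{u, v, w, w'} G E} {lam : ∀ b, Measure (E b)} [∀ b, SigmaFinite (lam b)]

theorem IsPositive.prod_map_absolutelyContinuous (hM : M.IsPositive lam) {S T : Finset (V × ℤ)}
    (hST : Disjoint S T) :
    (M.P.map fun ω (p : S) => M.X p.1 ω).prod (M.P.map fun ω (p : T) => M.X p.1 ω) ≪
      M.P.map fun ω => ((fun p : S => M.X p.1 ω), fun p : T => M.X p.1 ω) := by
  classical
  let e := MeasurableEquiv.piFinsetUnion (fun p : V × ℤ => E p.1) hST
  have hpi := (measurePreserving_piFinsetUnion hST fun p : V × ℤ => lam p.1).symm.map_eq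
  have hX : (M.P.map fun ω (p : ↥(S ∪ T)) => M.X p.1 ω).map e.symm =
      M.P.map fun ω => ((fun p : S => M.X p.1 ω), fun p : T => M.X p.1 ω) :=
    Measure.map_map e.symm.measurable (by fun_prop)
  have hunion := (hM (S ∪ T)).2.map e.symm.measurable
  rw [hpi, hX] at hunion
  exact ((hM S).1.prod (hM T).1).trans hunion

theorem IsPositive.prod_map_restrict_absolutelyContinuous (hM : M.IsPositive lam) {i : V × ℤ}
    {A : Set (V × ℤ)} (hA : A.Finite) (hi : i ∉ A) :
    (M.P.map (M.X i)).prod (M.P.map fun ω (p : A) => M.X p.1 ω) ≪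
      M.P.map fun ω => (M.X i ω, fun p : A => M.X p.1 ω) := by
  obtain ⟨F, rfl⟩ := hA.exists_finset_coe
  have heval : Measurable fun x : (∀ p : ({i} : Finset (V × ℤ)), E p.1.1) =>
      x ⟨i, Finset.mem_singleton_self i⟩ := measurable_pi_apply _
  have hprod := (hM.prod_map_absolutelyContinuous (Finset.disjoint_singleton_left.2 hi)).map
    (heval.prodMap (measurable_id (α := ∀ p : F, E p.1.1)))
  rwa [← Measure.map_prod_map _ _ heval measurable_id, Measure.map_id,
    Measure.map_map heval (by fun_prop), Measure.map_map (by fun_prop) (by fun_prop)] at hprod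

end Positivity

variable {V : Type u} [Finite V] {γmax : ℕ} {G : FTCG V γmax} {E : V → Type v}
  [∀ b, MeasurableSpace (E b)] (M : DSCM.{u, v, w, w'} G E)

section Solve

variable {t₀ : ℤ} {S : Set (V × ℤ)} (hS : ∀ p ∈ S, t₀ ≤ p.2)

open Classical in
/-- The trajectory computed on `S` by the mechanisms of `M` with the noises `u`, and equal to `z`
outside `S`. The lower bound `t₀` on the times in `S` makes the recursion well-founded. -/
noncomputable def solve (z : ∀ p : V × ℤ, E p.1) (u : ∀ p : S, M.Noise p.1.1) :
    ∀ p : V × ℤ, E p.1 :=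
  (G.wellFounded_from t₀).fix (C := fun p => E p.1) fun p rec =>
    if hp : p ∈ S then
      M.f p.1 (fun q => rec (q.1.1, q.1.2 + p.2) ⟨q.edge p.2, hS p hp⟩) (u ⟨p, hp⟩)
    else z p

theorem solve_of_mem (z : ∀ p : V × ℤ, E p.1) (u : ∀ p : S, M.Noise p.1.1) {p : V × ℤ}
    (hp : p ∈ S) :
    M.solve hS z u p = M.f p.1 (fun q => M.solve hS z u (q.1.1, q.1.2 + p.2)) (u ⟨p, hp⟩) := by
  rw [solve, WellFounded.fix_eq, dif_pos hp]

theorem solve_of_notMem (z : ∀ p : V × ℤ, E p.1) (u : ∀ p : S, M.Noise p.1.1) {p : V × ℤ}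
    (hp : p ∉ S) : M.solve hS z u p = z p := by
  rw [solve, WellFounded.fix_eq, dif_neg hp]

theorem measurable_solve (p : V × ℤ) :
    Measurable fun c : (∀ p : V × ℤ, E p.1) × (∀ p : S, M.Noise p.1.1) =>
      M.solve hS c.1 c.2 p := by
  induction p using (G.wellFounded_from t₀).induction with
  | _ p ih =>
    by_cases hp : p ∈ S
    · simp only [M.solve_of_mem hS _ _ hp]
      exact (M.measurable_f p.1).comp ((measurable_pi_lambda _ fun q =>
        ih (q.1.1, q.1.2 + p.2) ⟨q.edge p.2, hS p hp⟩).prodMk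
          ((measurable_pi_apply (⟨p, hp⟩ : S)).comp measurable_snd))
    · simp only [M.solve_of_notMem hS _ _ hp]
      fun_prop

theorem solve_eq_of_structural {x z : ∀ p : V × ℤ, E p.1} {u : ∀ p : V × ℤ, M.Noise p.1}
    (hx : ∀ p ∈ S, x p = M.f p.1 (fun q => x (q.1.1, q.1.2 + p.2)) (u p))
    (hpar : ∀ p ∈ S, ∀ q, G.Edge q p → q ∈ S ∨ z q = x q) {p : V × ℤ}
    (hp : p ∈ S ∨ z p = x p) : M.solve hS z (fun p => u p.1) p = x p := by
  induction p using (G.wellFounded_from t₀).induction with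
  | _ p ih =>
    by_cases hpS : p ∈ S
    · rw [M.solve_of_mem hS z _ hpS, hx p hpS]
      congr 1
      funext q
      exact ih _ ⟨q.edge p.2, hS p hpS⟩ (hpar p hpS _ (q.edge p.2))
    · rw [M.solve_of_notMem hS z _ hpS]
      exact hp.resolve_left hpS

end Solve

theorem ae_structural : ∀ᵐ ω ∂M.P, ∀ p : V × ℤ,
    M.X p ω = M.f p.1 (fun q => M.X (q.1.1, q.1.2 + p.2) ω) (M.U p ω) := by
  have : Countable V := Finite.to_countable
  exact ae_all_iff.2 fun p => M.structural p.1 p.2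

theorem doX_eq_of_not_isAnc {i p : V × ℤ} (a : E i.1) {ω : M.Ω}
    (hω : ∀ p : V × ℤ, M.X p ω = M.f p.1 (fun q => M.X (q.1.1, q.1.2 + p.2) ω) (M.U p ω))
    (hp : ¬ SCG.IsAnc G.toDigraph i p) : M.doX i a ω p = M.X p ω := by
  induction p using (G.wellFounded_from i.2).induction with
  | _ p ih =>
    by_cases hlt : p.2 < i.2
    · exact M.doX_of_lt i a ω p hlt
    · rw [M.doX_of_ne i a ω p (not_lt.1 hlt) (fun h => hp (h ▸ .refl)), hω p]
      congr 1
      funext q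
      exact ih _ ⟨q.edge p.2, not_lt.1 hlt⟩ fun hq => hp (hq.tail (q.edge p.2))

theorem indepFun_noise_of_not_isAnc {t₀ : ℤ} {S B : Set (V × ℤ)} (hS : ∀ p ∈ S, t₀ ≤ p.2)
    (hSB : ∀ p ∈ S, ∀ q ∈ B, ¬ SCG.IsAnc G.toDigraph p q) :
    (fun ω (p : S) => M.U p.1 ω) ⟂ᵢ[M.P] (fun ω (p : B) => M.X p.1 ω) := by
  -- The variables in `B` are functions of the past of `t₀` and of the noises of their ancestors
  -- from time `t₀` on, none of which lies in `S`.
  let past : Set (V × ℤ) := {p | p.2 < t₀}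
  let T : Set (V × ℤ) := {p | t₀ ≤ p.2 ∧ ∃ q ∈ B, SCG.IsAnc G.toDigraph p q}
  have hT : ∀ p ∈ T, t₀ ≤ p.2 := fun _ hp => hp.1
  have hST : Disjoint S T := Set.disjoint_left.2 fun p hp ⟨_, q, hq, hpq⟩ => hSB p hp q hq hpq
  have hnoise := indepFun_restrict_of_disjoint M.noise_indep M.measurable_U hST
  have hpast : (fun ω => ((fun p : S => M.U p.1 ω), fun p : T => M.U p.1 ω)) ⟂ᵢ[M.P]
      (fun ω (p : past) => M.X p.1 ω) :=
    (M.noise_indep_past t₀).comp (ψ := id)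
      (φ := fun c => ((fun p : S => c ⟨p.1, hS _ p.2⟩), fun p : T => c ⟨p.1, hT _ p.2⟩))
      (by fun_prop) measurable_id
  have hind := indepFun_prodMk_of_indepFun_prodMk (by fun_prop) (by fun_prop) (by fun_prop)
    hnoise hpast
  obtain ⟨ω₀⟩ := M.P.nonempty_of_neZero
  let F (c : (∀ p : T, M.Noise p.1.1) × (∀ p : past, E p.1.1)) (p : B) : E p.1.1 :=
    M.solve hT (updateSet (fun p => M.X p ω₀) past c.2) c.1 p.1
  have hF : Measurable F := measurable_pi_lambda _ fun p =>
    (M.measurable_solve hT p.1).comp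
      (((measurable_updateSet _).comp measurable_snd).prodMk measurable_fst)
  refine (hind.comp (φ := id) measurable_id hF).congr (.refl _ _) ?_
  filter_upwards [M.ae_structural] with ω hω
  have hmem (p : V × ℤ) (hp : ∃ q ∈ B, SCG.IsAnc G.toDigraph p q) : p ∈ T ∨
      updateSet (fun p => M.X p ω₀) past (fun p => M.X p.1 ω) p = M.X p ω :=
    (le_or_gt t₀ p.2).imp (fun h => ⟨h, hp⟩) fun h => updateSet_of_mem _ _ h
  funext p
  refine M.solve_eq_of_structural hT (fun p _ => hω p) ?_ (hmem p.1 ⟨p, p.2, .refl⟩)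
  rintro p ⟨-, r, hr, hpr⟩ q hqp
  exact hmem q ⟨r, hr, .head hqp hpr⟩

theorem exists_measurable_outcome_eq [∀ b, Nonempty (E b)] {i j : V × ℤ} {A S : Set (V × ℤ)}
    (hiA : ∀ q ∈ A, ¬ SCG.IsAnc G.toDigraph i q) (hS : ∀ p ∈ S, i.2 ≤ p.2) (hiS : i ∉ S)
    (hj : j ∈ S ∨ j ∈ insert i A) (hpar : ∀ p ∈ S, ∀ q, G.Edge q p → q ∈ S ∨ q ∈ insert i A) :
    ∃ H : (E i.1 × ∀ p : A, E p.1.1) × (∀ p : S, M.Noise p.1.1) → E j.1, Measurable H ∧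
      (∀ᵐ ω ∂M.P, M.X j ω = H ((M.X i ω, fun p => M.X p.1 ω), fun p => M.U p.1 ω)) ∧
      ∀ a, ∀ᵐ ω ∂M.P, M.doX i a ω j = H ((a, fun p => M.X p.1 ω), fun p => M.U p.1 ω) := by
  classical
  let z (c : E i.1 × ∀ p : A, E p.1.1) : ∀ p : V × ℤ, E p.1 :=
    Function.update (updateSet (fun _ => Classical.arbitrary _) A c.2) i c.1
  have hz : Measurable z :=
    measurable_update'.comp (((measurable_updateSet _).comp measurable_snd).prodMk measurable_fst)
  have z_eq (x : ∀ p : V × ℤ, E p.1) (q : V × ℤ) (hq : q ∈ insert i A) :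
      z (x i, fun p => x p.1) q = x q := by
    obtain rfl | hqi := eq_or_ne q i
    · exact Function.update_self ..
    · simp only [z, Function.update_of_ne hqi, updateSet_of_mem _ _ (hq.resolve_left hqi)]
  have solve_eq (x : ∀ p : V × ℤ, E p.1) (u : ∀ p : V × ℤ, M.Noise p.1)
      (hx : ∀ p ∈ S, x p = M.f p.1 (fun q => x (q.1.1, q.1.2 + p.2)) (u p)) :
      M.solve hS (z (x i, fun p => x p.1)) (fun p => u p.1) j = x j :=
    M.solve_eq_of_structural hS hx (fun p hp q hq => (hpar p hp q hq).imp_right (z_eq x q))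
      (hj.imp_right (z_eq x j))
  refine ⟨fun c => M.solve hS (z c.1) c.2 j,
    (M.measurable_solve hS j).comp ((hz.comp measurable_fst).prodMk measurable_snd), ?_, ?_⟩
  · filter_upwards [M.ae_structural] with ω hω
    exact (solve_eq (fun p => M.X p ω) (fun p => M.U p ω) fun p _ => hω p).symm
  · intro a
    filter_upwards [M.ae_structural] with ω hω
    have hx := solve_eq (M.doX i a ω) (fun p => M.U p ω) fun p hp =>
      M.doX_of_ne i a ω p (hS p hp) fun h => hiS (h ▸ hp)
    rw [← hx, M.doX_self, funext fun p : A => M.doX_eq_of_not_isAnc a hω (hiA p p.2)]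

theorem adjustmentFormula_of_separated [∀ b, StandardBorelSpace (E b)] [∀ b, Nonempty (E b)]
    {lam : ∀ b, Measure (E b)} [∀ b, SigmaFinite (lam b)] (hM : M.IsPositive lam) {i j : V × ℤ}
    {A S : Set (V × ℤ)} (hA : A.Finite) (hiA : ∀ q ∈ A, ¬ SCG.IsAnc G.toDigraph i q)
    (hS : ∀ p ∈ S, i.2 ≤ p.2) (hiS : i ∉ S) (hj : j ∈ S ∨ j ∈ insert i A)
    (hpar : ∀ p ∈ S, ∀ q, G.Edge q p → q ∈ S ∨ q ∈ insert i A)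
    (hsep : ∀ p ∈ S, ∀ q ∈ insert i A, ¬ SCG.IsAnc G.toDigraph p q) :
    M.AdjustmentFormula i j A := by
  obtain ⟨H, hH, hobs, hdo⟩ := M.exists_measurable_outcome_eq hiA hS hiS hj hpar
  have hind := (M.indepFun_noise_of_not_isAnc hS hsep).symm.comp (ψ := id)
    (φ := fun c => (c ⟨i, Set.mem_insert i A⟩, fun p : A => c ⟨p.1, Set.mem_insert_of_mem _ p.2⟩))
    (by fun_prop) measurable_id
  filter_upwards [ae_map_eq_lintegral_condDistrib (M.measurable_X i) (by fun_prop) (by fun_prop)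
    (M.measurable_X j) hH hobs hind
    (hM.prod_map_restrict_absolutelyContinuous hA fun h => hiA i h .refl)] with a ha B hB
  rw [← ha B hB, effect, Measure.map_congr (hdo a)]

end DSCM

namespace SCG

variable {V : Type u} {E : V → Type v} [∀ b, MeasurableSpace (E b)]
  [∀ b, StandardBorelSpace (E b)] [∀ b, Nonempty (E b)]

open Classical in
/-- The right-hand side of the adjustment formula, as a functional of the observational law `μ`.
It is total: a law that is not finite gets the value `0`. -/
noncomputable def adjustmentFunctional (i j : V × ℤ) (Z : Set (V × ℤ))
    (μ : Measure (∀ p : V × ℤ, E p.1)) (a : E i.1) : Measure (E j.1) :=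
  if _ : IsFiniteMeasure μ then
    (μ.map fun x (p : Z) => x p.1).bind fun z =>
      condDistrib (fun x => x j) (fun x => (x i, fun p : Z => x p.1)) μ (a, z)
  else 0

theorem IsValidAdjustmentSet.isIdentifiable [Finite V] {lam : ∀ b, Measure (E b)} {Gs : Digraph V}
    {γmax : ℕ} {i j : V × ℤ} {Z : Set (V × ℤ)}
    (h : IsValidAdjustmentSet.{u, v, w, w'} E lam Gs γmax i j Z) :
    IsIdentifiable.{u, v, w, w'} E lam Gs γmax i j := by
  refine ⟨adjustmentFunctional i j Z, fun G hG M hM => ?_⟩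
  have hX : Measurable fun ω p => M.X p ω := by fun_prop
  have : IsFiniteMeasure M.obsLaw := by rw [DSCM.obsLaw]; infer_instance
  have hmap : M.obsLaw.map (fun x (p : Z) => x p.1) = M.P.map fun ω (p : Z) => M.X p.1 ω :=
    Measure.map_map (by fun_prop) hX
  have hcond : condDistrib (fun x => x j) (fun x => (x i, fun p : Z => x p.1)) M.obsLaw =
      condDistrib (M.X j) (fun ω => (M.X i ω, fun p : Z => M.X p.1 ω)) M.P :=
    (condDistrib_comp_eq_condDistrib_map (by fun_prop) (by fun_prop) hX).symm
  filter_upwards [h G hG M hM] with a ha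
  ext B hB
  rw [ha B hB, adjustmentFunctional, dif_pos this, hmap, hcond, Measure.bind_apply hB]
  exact ((Kernel.measurable _).comp measurable_prodMk_left).aemeasurable

end SCG

theorem mainTheorem2 {V : Type u} [Finite V] (E : V → Type v) [∀ b, MeasurableSpace (E b)]
    [∀ b, StandardBorelSpace (E b)] [∀ b, Nonempty (E b)]
    (lam : ∀ b, Measure (E b)) [∀ b, SigmaFinite (lam b)]
    (Gs : Digraph V) (γmax γ : ℕ) (t : ℤ) (x y : V) (hxy : x ≠ y)
    (h : ¬ SCG.IsAnc Gs x y ∨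
      (SCG.IsAnc Gs x y ∧ ¬ SCG.CycleCondition Gs x y γ ∧ ¬ SCG.BackdoorCondition Gs x y γ)) :
    SCG.IsIdentifiable.{u, v, w, w'} E lam Gs γmax (x, t - γ) (y, t) ∧
      SCG.IsValidAdjustmentSet.{u, v, w, w'} E lam Gs γmax (x, t - γ) (y, t)
        (SCG.adjustmentSet Gs γmax x γ t) := by
  suffices hv : SCG.IsValidAdjustmentSet.{u, v, w, w'} E lam Gs γmax (x, t - γ) (y, t)
      (SCG.adjustmentSet Gs γmax x γ t) from ⟨hv.isIdentifiable, hv⟩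
  intro G hG M hM
  refine M.adjustmentFormula_of_separated hM
    (S := G.outcomeAncestors (SCG.adjustmentSet Gs γmax x γ t) (x, t - γ) (y, t))
    (SCG.finite_adjustmentSet ..) (fun q hq => hG.not_isAnc_treatment_adjustmentSet hq)
    (fun p hp => hp.1) (fun hp => hp.2.2.1 rfl) ?_ ?_ ?_
  · by_cases hj : (y, t) ∈ SCG.adjustmentSet Gs γmax x γ t
    · exact .inr (.inr hj)
    · exact .inl ⟨by simp, hj, fun h => hxy (congrArg Prod.fst h).symm, .refl⟩
  · exact fun p hp q hq => (FTCG.mem_outcomeAncestors_or_of_edge hp hq).imp_right Or.symm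
  · rintro p hp q (rfl | hq)
    · exact hG.not_isAnc_outcomeAncestors_treatment hxy h hp
    · exact hG.not_isAnc_outcomeAncestors_adjustmentSet hp hq
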